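/- Let $p:\mathbb{R}\to\mathbb{S}^1$, $p(x)=e^{2\pi i x}$, and let $\mathcal{U}=\{U_i\}_{i\in I}$ be a finite good cover of $\mathbb{S}^1$, that is, a finite open cover such that every nonempty intersection of members of $\mathcal{U}$ is contractible. For a continuous map $g:Z\to Y$ and a family $\mathcal{V}=\{V_j\}_{j\in J}$ of subsets of $Y$, let $\mathrm{Nrv}(\mathcal{V})$ be the nerve, i.e. the simplicial complex of finite nonempty $\sigma\subset J$ with $\bigcap_{j\in\sigma}V_j\neq\emptyset$; let $g^*\mathcal{V}$ be the family of all path components $A$ of the sets $g^{-1}(V_j)$, indexed by the pairs $(j,A)$ with $A\in\pi_0(g^{-1}(V_j))$; and let $\mathrm{Mapp}(\mathcal{V},g):=\mathrm{Nrv}(g^*\mathcal{V})$ be the mapper complex, with the simplicial map $\mathrm{Mapp}(\mathcal{V},g)\to\mathrm{Nrv}(\mathcal{V})$, $(j,A)\mapsto j$. Let $X$ be a topological space, $f:X\to\mathbb{S}^1$ a continuous map, and $f':X\times_{\mathbb{S}^1}\mathbb{R}\to\mathbb{R}$ the pullback of $f$ along $p$. Let $F:\mathrm{Mapp}(\mathcal{U},f)\to\mathrm{Nrv}(\mathcal{U})$,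 $F^*:\mathrm{Mapp}(p^*\mathcal{U},f')\to\mathrm{Nrv}(p^*\mathcal{U})$ and $P:\mathrm{Nrv}(p^*\mathcal{U})=\mathrm{Mapp}(\mathcal{U},p)\to\mathrm{Nrv}(\mathcal{U})$ be the simplicial maps just described, and let $P^*:\mathrm{Mapp}(p^*\mathcal{U},f')\to\mathrm{Mapp}(\mathcal{U},f)$ be the simplicial map that sends a path component of $(f')^{-1}(V)$, where $V$ is a path component of $p^{-1}(U_i)$, to the path component of $f^{-1}(U_i)$ that contains its image under the projection $X\times_{\mathbb{S}^1}\mathbb{R}\to X$. Then, after geometric realization (with the weak topology), the square $$\begin{array}{ccc}\mathrm{Mapp}(p^*\mathcal{U},f') & \xrightarrow{F^*} & \mathrm{Nrv}(p^*\mathcal{U})\\ {\scriptstyle P^*}\downarrow & & \downarrow{\scriptstyle P}\\ \mathrm{Mapp}(\mathcal{U},f) & \xrightarrow{F} & \mathrm{Nrv}(\mathcal{U})\end{array}$$ is a pullback square in the category $\mathrm{Top}$ of topological spaces, and $P^*$ is a covering map. In particular this holds when $\mathcal{U}$ is moreover minimal and has only pairwise nonempty intersections, in which case the four complexes are graphs.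 -/

import Mathlib

open CategoryTheory

universe u v w

noncomputable section

namespace MapperGraph

/-! ### Simplicial maps and geometric realization of abstract simplicial complexes -/

/-- A simplicial map `K → L`: a map of vertices that sends faces to faces. -/
structure SimplicialMap {V : Type u} {W : Type v} (K : PreAbstractSimplicialComplex V)
    (L : PreAbstractSimplicialComplex W) where
  toFun : V → W
  map_face : ∀ σ ∈ K.faces, ∃ τ ∈ L.faces, (τ : Set W) = toFun '' (σ : Set V)

/-- The underlying set of the geometric realization of `K`: barycentric coordinates
`α ≥ 0` with sum `1`, whose support is a face of `K`. -/
def Realization {V : Type u} (K : PreAbstractSimplicialComplex V) : Type u :=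
  {α : V →₀ ℝ // (∀ x, 0 ≤ α x) ∧ (α.sum fun _ r => r) = 1 ∧ α.support ∈ K.faces}

namespace Realization

variable {V : Type u} {W : Type v} {K : PreAbstractSimplicialComplex V}
  {L : PreAbstractSimplicialComplex W}

/-- The closed geometric simplex of `|K|` spanned by a face `σ`. -/
def ClosedSimplex (K : PreAbstractSimplicialComplex V) (σ : K.faces) : Type u :=
  {α : Realization K // α.1.support ⊆ σ.1}

/-- Closed simplices carry the Euclidean topology of their (finitely many nonzero)
barycentric coordinates. -/
instance (σ : K.faces) : TopologicalSpace (ClosedSimplex K σ) :=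
  TopologicalSpace.induced (fun α (x : V) => α.1.1 x) Pi.topologicalSpace

/-- The inclusion of a closed simplex in `|K|`. -/
def ClosedSimplex.incl (σ : K.faces) : ClosedSimplex K σ → Realization K := Subtype.val

/-- The geometric realization carries the weak (coherent) topology: the finest topology for
which the inclusions of all closed simplices are continuous. -/
instance : TopologicalSpace (Realization K) :=
  ⨆ σ : K.faces, TopologicalSpace.coinduced (ClosedSimplex.incl σ) inferInstance

theorem sum_mapDomain (g : V → W) (α : V →₀ ℝ) :
    ((α.mapDomain g).sum fun _ r => r) = α.sum fun _ r => r :=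
  Finsupp.sum_mapDomain_index (fun _ => rfl) (fun _ _ _ => rfl)

theorem mapDomain_apply_eq_sum [DecidableEq W] (g : V → W) (α : V →₀ ℝ) (s : Finset V)
    (hs : α.support ⊆ s) (y : W) :
    α.mapDomain g y = ∑ x ∈ s, if g x = y then α x else 0 := by
  rw [Finsupp.mapDomain, Finsupp.sum_apply, Finsupp.sum_of_support_subset _ hs]
  · refine Finset.sum_congr rfl fun x _ => ?_
    rw [Finsupp.single_apply]
  · intro x _
    simp

theorem mapDomain_nonneg (g : V → W) (α : V →₀ ℝ) (h : ∀ x, 0 ≤ α x) (y : W) :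
    0 ≤ α.mapDomain g y := by
  classical
  rw [mapDomain_apply_eq_sum g α α.support subset_rfl]
  exact Finset.sum_nonneg fun x _ => by split_ifs <;> simp [h]

theorem support_mapDomain (g : V → W) (α : V →₀ ℝ) (h : ∀ x, 0 ≤ α x) :
    ((α.mapDomain g).support : Set W) = g '' (α.support : Set V) := by
  classical
  refine Set.Subset.antisymm ?_ ?_
  · have h1 : (α.mapDomain g).support ⊆ α.support.image g := Finsupp.mapDomain_support
    intro y hy
    have h2 := h1 (Finset.mem_coe.1 hy)
    simpa using h2
  · rintro _ ⟨x, hx, rfl⟩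
    have hx0 : α x ≠ 0 := by simpa using hx
    have hpos : 0 < α x := lt_of_le_of_ne (h x) (Ne.symm hx0)
    have : 0 < α.mapDomain g (g x) := by
      rw [mapDomain_apply_eq_sum g α α.support subset_rfl]
      refine Finset.sum_pos' (fun z _ => by split_ifs <;> simp [h]) ⟨x, by simpa using hx0, ?_⟩
      simpa using hpos
    simpa using this.ne'

/-- The affine extension of a simplicial map, on points of the realization. -/
def mapFun (g : SimplicialMap K L) (α : Realization K) : Realization L :=
  ⟨α.1.mapDomain g.toFun, mapDomain_nonneg _ _ α.2.1, by
    rw [sum_mapDomain]; exact α.2.2.1, by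
    obtain ⟨τ, hτ, h⟩ := g.map_face _ α.2.2.2
    have : (α.1.mapDomain g.toFun).support = τ := by
      apply Finset.coe_injective
      rw [support_mapDomain _ _ α.2.1, h]
    rw [this]; exact hτ⟩

theorem continuous_mapFun (g : SimplicialMap K L) : Continuous (mapFun g) := by
  classical
  refine continuous_iSup_dom.2 fun σ => continuous_coinduced_dom.2 ?_
  obtain ⟨τ, hτ, h⟩ := g.map_face _ σ.2
  let G : ClosedSimplex K σ → ClosedSimplex L ⟨τ, hτ⟩ := fun α => ⟨mapFun g α.1, by
    intro y hy
    have h1 : y ∈ ((α.1.1.mapDomain g.toFun).support : Set W) := hy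
    rw [support_mapDomain _ _ α.1.2.1] at h1
    have h2 : y ∈ (τ : Set W) := by
      rw [h]; exact Set.image_mono (Finset.coe_subset.2 α.2) h1
    exact h2⟩
  have hG : Continuous G := by
    refine continuous_induced_rng.2 (continuous_pi fun y => ?_)
    have : (fun α : ClosedSimplex K σ => (G α).1.1 y) =
        fun α => ∑ x ∈ σ.1, if g.toFun x = y then α.1.1 x else 0 := by
      funext α
      exact mapDomain_apply_eq_sum g.toFun α.1.1 σ.1 α.2 y
    change Continuous (fun α : ClosedSimplex K σ => (G α).1.1 y)
    rw [this]
    refine continuous_finsetSum _ fun x _ => ?_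
    split_ifs
    · exact (continuous_apply x).comp continuous_induced_dom
    · exact continuous_const
  have hincl : Continuous (ClosedSimplex.incl (K := L) ⟨τ, hτ⟩) :=
    continuous_iSup_rng (i := (⟨τ, hτ⟩ : L.faces)) continuous_coinduced_rng
  exact hincl.comp hG

/-- The continuous map `|K| → |L|` induced by a simplicial map `K → L`. -/
def map (g : SimplicialMap K L) : C(Realization K, Realization L) :=
  ⟨mapFun g, continuous_mapFun g⟩

end Realization

/-! ### Nerves, pulled back covers and mapper complexes -/

variable {ι : Type u} {X : Type v} {Y : Type w} [TopologicalSpace X] [TopologicalSpace Y]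

/-- The nerve of a family of sets: the faces are the nonempty finite sets of indices
for which the corresponding sets have a common point. -/
def nerve {ι : Type u} {Y : Type w} (U : ι → Set Y) : PreAbstractSimplicialComplex ι where
  faces := {σ | σ.Nonempty ∧ (⋂ i ∈ σ, U i).Nonempty}
  isRelLowerSet_faces := by
    rintro σ ⟨h1, y, hy⟩
    refine ⟨h1, fun τ hτ hne => ⟨hne, y, ?_⟩⟩
    simp only [Set.mem_iInter] at hy ⊢
    exact fun i hi => hy i (hτ hi)

/-- A good cover: an open cover all of whose nonempty finite intersections are contractible. -/
structure IsGoodCover (U : ι → Set Y) : Prop where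
  isOpen : ∀ i, IsOpen (U i)
  iUnion_eq : ⋃ i, U i = Set.univ
  contractible : ∀ σ ∈ (nerve U).faces, ContractibleSpace (⋂ i ∈ σ, U i : Set Y)

/-- The indices of the pulled back cover `f^*U`: pairs of an index `i` and a path component
of `f⁻¹(U i)`. -/
abbrev PullbackIndex (f : C(X, Y)) (U : ι → Set Y) : Type (max u v) :=
  Σ i, ZerothHomotopy (f ⁻¹' U i)

/-- The pulled back cover `f^*U`, the family of all path components of the sets `f⁻¹(U i)`,
each regarded as a subset of `X`. -/
def pullbackCover (f : C(X, Y)) (U : ι → Set Y) (a : PullbackIndex f U) : Set X :=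
  {x | ∃ h : x ∈ f ⁻¹' U a.1, ZerothHomotopy.mk (⟨x, h⟩ : f ⁻¹' U a.1) = a.2}

/-- The mapper complex `Mapp(U, f)`: the nerve of `f^*U`. -/
def mapper (U : ι → Set Y) (f : C(X, Y)) : PreAbstractSimplicialComplex (PullbackIndex f U) :=
  nerve (pullbackCover f U)

/-- The simplicial map `Mapp(U, f) → Nrv(U)` that sends a component of `f⁻¹(U i)` to `i`. -/
def mapperToNerve (U : ι → Set Y) (f : C(X, Y)) : SimplicialMap (mapper U f) (nerve U) where
  toFun a := a.1
  map_face := by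
    classical
    rintro σ ⟨h1, x, hx⟩
    refine ⟨σ.image Sigma.fst, ⟨h1.image _, f x, ?_⟩, by simp⟩
    simp only [Set.mem_iInter] at hx ⊢
    intro i hi
    obtain ⟨a, ha, rfl⟩ := Finset.mem_image.1 hi
    exact (hx a ha).1

section Unrolling

variable {E : Type*} [TopologicalSpace E] (p : C(E, Y)) (f : C(X, Y)) (U : ι → Set Y)

/-- The fibre product `X ×_Y E`. -/
abbrev FibreProduct : Type _ := {q : X × E // f q.1 = p q.2}

/-- The pullback `f' : X ×_Y E → E` of `f` along `p`. -/
def pullbackMap : C(FibreProduct p f, E) := ⟨fun q => q.1.2, by fun_prop⟩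

/-- The projection `X ×_Y E → X`, restricted to `f'⁻¹(V) → f⁻¹(U i)`, where `V` is a
component of `p⁻¹(U i)`. -/
def projRestrict (b : PullbackIndex p U) :
    C((pullbackMap p f) ⁻¹' (pullbackCover p U b), f ⁻¹' U b.1) :=
  ⟨fun q => ⟨q.1.1.1, by
    have h : p q.1.1.2 ∈ U b.1 := q.2.1
    rw [← q.1.2] at h
    exact h⟩, by fun_prop⟩

/-- On vertices, `P^*` sends a component of `f'⁻¹(V)`, where `V` is a component of `p⁻¹(U i)`,
to the component of `f⁻¹(U i)` into which it is projected. -/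
def unrollVertex (c : PullbackIndex (pullbackMap p f) (pullbackCover p U)) :
    PullbackIndex f U :=
  ⟨c.1.1, ZerothHomotopy.lift (fun q => ZerothHomotopy.mk (projRestrict p f U c.1 q))
    (fun _ _ γ => ZerothHomotopy.sound (γ.map (projRestrict p f U c.1).continuous)) c.2⟩

/-- The simplicial map `P^* : Mapp(p^*U, f') → Mapp(U, f)`. -/
def unrollMap :
    SimplicialMap (mapper (pullbackCover p U) (pullbackMap p f)) (mapper U f) where
  toFun := unrollVertex p f U
  map_face := by
    classical
    rintro σ ⟨h1, q, hq⟩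
    refine ⟨σ.image (unrollVertex p f U), ⟨h1.image _, q.1.1, ?_⟩, by simp⟩
    simp only [Set.mem_iInter] at hq ⊢
    intro a ha
    obtain ⟨c, hc, rfl⟩ := Finset.mem_image.1 ha
    obtain ⟨hm, he⟩ := hq c hc
    refine ⟨(projRestrict p f U c.1 ⟨q, hm⟩).2, ?_⟩
    simp only [unrollVertex, ← he, ZerothHomotopy.lift_mk]
    rfl

end Unrolling

/-- The universal covering `p : ℝ → 𝕊¹`, `p(x) = exp(2πix)`. -/
def circleCover : C(ℝ, Circle) := ⟨fun x => Circle.exp (2 * Real.pi * x), by fun_prop⟩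

end MapperGraph

end

/-!
Both assertions are consequences of one combinatorial fact: `P^*` is a simplicial covering. That is,
faces of `Mapp(U, f)` lift along `P^*` once a lift of one of their vertices is chosen, and vertices
adjacent to a common vertex are distinguished by their images (`IsSimplicialCovering`,
`isSimplicialCovering_unrollMap`).

On the level of covers, only lifting along the covering map `p` is used. Since `U i` is simply
connected, a component of `p⁻¹(U i)` is mapped injectively to `U i` (`injOn_pullbackCover`). Since
`U i ∩ U j` is path connected, two components of `p⁻¹(U i)` and `p⁻¹(U j)` that meet do so over every
point of `U i ∩ U j` (`surjOn_inter_pullbackCover`). Hence `P` is locally injective. Lifting paths of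
`f⁻¹(U i)` to the fibre product shows that a component of `f'⁻¹(V)`, for `V` a component of
`p⁻¹(U i)`, is the same as a component of `f⁻¹(U i)`, so that the square is cartesian on vertices
(`unrollVertex_injective`, `exists_unrollVertex_eq`). A face of `Mapp(U, f)` is lifted by lifting a
common point of its members.

After realization, a simplicial covering is injective on open stars of vertices
(`Realization.injOn_openStar`). Over a closed simplex it has a continuous section through each lift
of a vertex (`Realization.exists_section`), so by the definition of the weak topology it is an open
map (`Realization.isOpenMap_map`). The preimage of the open star of a vertex is therefore the
disjoint union of homeomorphic copies, and the map is a covering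
(`Realization.isCoveringMap_map`). The comparison map from the upper left corner to the fibre product
is a bijection whose inverse is locally the local inverse of `|P^*|`, so it is a homeomorphism
(`Realization.isPullback_map`). No local finiteness is needed.
-/

noncomputable section

namespace MapperGraph

/-! ### Simplicial coverings -/

section SimplicialCovering

variable {V : Type u} {W : Type v} {K : PreAbstractSimplicialComplex V}
  {L : PreAbstractSimplicialComplex W}

/-- Two (possibly equal) vertices of `K` are adjacent if some face contains both of them. -/
def Adj (K : PreAbstractSimplicialComplex V) (v w : V) : Prop :=
  ∃ τ ∈ K.faces, v ∈ τ ∧ w ∈ τ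

/-- A simplicial map is locally injective if it is injective on the vertices adjacent to any
given vertex. In particular it is then injective on every face. -/
def SimplicialMap.IsLocallyInjective (q : SimplicialMap K L) : Prop :=
  ∀ ⦃v w w' : V⦄, Adj K v w → Adj K v w' → q.toFun w = q.toFun w' → w = w'

/-- A simplicial covering: a locally injective simplicial map along which faces lift, with a
prescribed lift of one of their vertices. -/
structure SimplicialMap.IsSimplicialCovering (q : SimplicialMap K L) : Prop where
  isLocallyInjective : q.IsLocallyInjective
  exists_lift : ∀ (v : V), ∀ σ ∈ L.faces, q.toFun v ∈ σ →
    ∃ τ ∈ K.faces, v ∈ τ ∧ q.toFun '' (τ : Set V) = σ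

namespace Realization

theorem isOpen_iff {s : Set (Realization K)} :
    IsOpen s ↔ ∀ σ : K.faces, IsOpen (ClosedSimplex.incl σ ⁻¹' s) := by
  refine isOpen_iSup_iff.trans (forall_congr' fun σ => ?_)
  exact isOpen_coinduced

theorem continuous_incl (σ : K.faces) : Continuous (ClosedSimplex.incl (K := K) σ) :=
  continuous_iSup_rng (i := σ) continuous_coinduced_rng

theorem continuous_coord (v : V) : Continuous fun α : Realization K => α.1 v := by
  refine continuous_iSup_dom.2 fun σ => continuous_coinduced_dom.2 ?_
  exact (continuous_apply v).comp continuous_induced_dom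

/-- The open star of a vertex in the geometric realization. -/
def openStar (K : PreAbstractSimplicialComplex V) (v : V) : Set (Realization K) :=
  {α | 0 < α.1 v}

theorem isOpen_openStar (v : V) : IsOpen (openStar K v) :=
  isOpen_lt continuous_const (continuous_coord v)

theorem mem_openStar_iff {v : V} {α : Realization K} : α ∈ openStar K v ↔ v ∈ α.1.support := by
  rw [Finsupp.mem_support_iff]
  exact ⟨fun h => ne_of_gt h, fun h => lt_of_le_of_ne (α.2.1 v) h.symm⟩

theorem exists_mem_openStar (α : Realization K) : ∃ v, α ∈ openStar K v :=
  (K.isRelLowerSet_faces α.2.2.2).1.imp fun _ h => mem_openStar_iff.2 h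

theorem adj_of_mem_openStar {v w : V} {α : Realization K} (hv : α ∈ openStar K v)
    (hw : α ∈ openStar K w) : Adj K v w :=
  ⟨_, α.2.2.2, mem_openStar_iff.1 hv, mem_openStar_iff.1 hw⟩

theorem map_mem_openStar_iff (q : SimplicialMap K L) {α : Realization K} {y : W} :
    map q α ∈ openStar L y ↔ ∃ v, α ∈ openStar K v ∧ q.toFun v = y := by
  have h := Set.ext_iff.1 (support_mapDomain q.toFun α.1 α.2.1) y
  simp only [mem_openStar_iff]
  exact h

theorem map_mem_openStar (q : SimplicialMap K L) {α : Realization K} {v : V}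
    (h : α ∈ openStar K v) : map q α ∈ openStar L (q.toFun v) :=
  (map_mem_openStar_iff q).2 ⟨v, h, rfl⟩

/-- A locally injective simplicial map keeps the nonzero barycentric coordinates. -/
theorem map_apply_of_isLocallyInjective {q : SimplicialMap K L} (hq : q.IsLocallyInjective)
    {α : Realization K} {w : V} (hw : α ∈ openStar K w) :
    (map q α).1 (q.toFun w) = α.1 w := by
  refine Finsupp.mapDomain_apply' (α.1.support : Set V) α.1 subset_rfl ?_
    (mem_openStar_iff.1 hw)
  intro a ha b hb hab
  exact hq ⟨_, α.2.2.2, ha, ha⟩ ⟨_, α.2.2.2, ha, hb⟩ hab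

/-- A point of the open star of `v` is determined by its image: its support lies among the vertices
adjacent to `v`, on which `q` is injective. -/
theorem injOn_openStar {q : SimplicialMap K L} (hq : q.IsLocallyInjective) (v : V) :
    Set.InjOn (map q) (openStar K v) := by
  have key : ∀ α ∈ openStar K v, ∀ β ∈ openStar K v, map q α = map q β →
      ∀ w, α ∈ openStar K w → α.1 w = β.1 w := by
    intro α hα β hβ h w hw
    obtain ⟨w', hw', hww'⟩ := (map_mem_openStar_iff q).1 (h ▸ map_mem_openStar q hw)
    obtain rfl : w = w' :=
      hq (adj_of_mem_openStar hα hw) (adj_of_mem_openStar hβ hw') hww'.symm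
    rw [← map_apply_of_isLocallyInjective hq hw, h, map_apply_of_isLocallyInjective hq hw']
  intro α hα β hβ h
  refine Subtype.ext (Finsupp.ext fun w => ?_)
  by_cases hw : α ∈ openStar K w
  · exact key α hα β hβ h w hw
  by_cases hw' : β ∈ openStar K w
  · exact (key β hβ α hα h.symm w hw').symm
  rw [mem_openStar_iff, Finsupp.notMem_support_iff] at hw hw'
  rw [hw, hw']

/-- Over a closed simplex with a vertex `q v`, a simplicial covering `q` has a section through
the lift of this simplex that contains `v`. -/
theorem exists_section {q : SimplicialMap K L} (hq : q.IsSimplicialCovering) (v : V)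
    (σ : L.faces) (hv : q.toFun v ∈ σ.1) :
    ∃ G : ClosedSimplex L σ → Realization K, Continuous G ∧
      ∀ α, map q (G α) = α.1 ∧ (G α).1 v = α.1.1 (q.toFun v) := by
  classical
  obtain ⟨τ, hτ, hvτ, himg⟩ := hq.exists_lift v σ.1 σ.2 hv
  have hinj : Set.InjOn q.toFun (τ : Set V) := fun a ha b hb hab =>
    hq.isLocallyInjective ⟨τ, hτ, ha, ha⟩ ⟨τ, hτ, ha, hb⟩ hab
  have himg' : τ.image q.toFun = σ.1 := Finset.coe_injective (by rw [Finset.coe_image, himg])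
  -- The section transports barycentric coordinates along the bijection `q : τ → σ`.
  let g : ClosedSimplex L σ → V →₀ ℝ := fun α => Finsupp.indicator τ fun w _ => α.1.1 (q.toFun w)
  have hg : ∀ α w, w ∈ τ → g α w = α.1.1 (q.toFun w) := fun α w hw =>
    Finsupp.indicator_of_mem hw _
  have hg0 : ∀ α w, w ∉ τ → g α w = 0 := fun α w hw => Finsupp.indicator_of_notMem hw _
  have hsupp : ∀ α, (g α).support ⊆ τ := fun α => Finsupp.support_indicator_subset ..
  have hmap : ∀ α, (g α).mapDomain q.toFun = α.1.1 := by
    intro α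
    ext y
    by_cases hy : y ∈ σ.1
    · rw [← himg'] at hy
      obtain ⟨w, hw, rfl⟩ := Finset.mem_image.1 hy
      rw [Finsupp.mapDomain_apply' (τ : Set V) _ (Finset.coe_subset.2 (hsupp α)) hinj hw,
        hg α w hw]
    · rw [Finsupp.notMem_support_iff.1 fun h => hy (α.2 h), ← Finsupp.notMem_support_iff]
      intro h
      refine hy (himg' ▸ Finset.image_subset_image (hsupp α) (Finsupp.mapDomain_support h))
  have hsum : ∀ α, ((g α).sum fun _ r => r) = 1 := fun α => by
    rw [← sum_mapDomain q.toFun, hmap]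
    exact α.1.2.2.1
  have hface : ∀ α, (g α).support ∈ K.faces := fun α => by
    refine (K.isRelLowerSet_faces hτ).2 (hsupp α) (Finsupp.support_nonempty_iff.2 fun h => ?_)
    have := hsum α
    rw [h, Finsupp.sum_zero_index] at this
    exact zero_ne_one this
  have hnonneg : ∀ α w, 0 ≤ g α w := fun α w => by
    by_cases hw : w ∈ τ
    · rw [hg α w hw]; exact α.1.2.1 _
    · rw [hg0 α w hw]
  let G : ClosedSimplex L σ → ClosedSimplex K ⟨τ, hτ⟩ := fun α =>
    ⟨⟨g α, hnonneg α, hsum α, hface α⟩, hsupp α⟩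
  have hG : Continuous G := by
    refine continuous_induced_rng.2 (continuous_pi fun w => ?_)
    change Continuous fun α => g α w
    by_cases hw : w ∈ τ
    · simp only [hg _ w hw]
      exact (continuous_apply (q.toFun w)).comp continuous_induced_dom
    · simp only [hg0 _ w hw]
      exact continuous_const
  exact ⟨fun α => (G α).1, (continuous_incl _).comp hG,
    fun α => ⟨Subtype.ext (hmap α), hg α v hvτ⟩⟩

theorem surjOn_openStar {q : SimplicialMap K L} (hq : q.IsSimplicialCovering) (v : V) :
    Set.SurjOn (map q) (openStar K v) (openStar L (q.toFun v)) := by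
  intro α hα
  obtain ⟨G, -, hG⟩ := exists_section hq v ⟨_, α.2.2.2⟩ (mem_openStar_iff.1 hα)
  obtain ⟨h1, h2⟩ := hG ⟨α, subset_rfl⟩
  exact ⟨_, hα.trans_eq h2.symm, h1⟩

/-- The image of an open subset of the open star of `v` is open: in each closed simplex with vertex
`q v`, it is the preimage of this subset under a continuous section. -/
theorem isOpenMap_map {q : SimplicialMap K L} (hq : q.IsSimplicialCovering) :
    IsOpenMap (map q) := by
  intro s hs
  have hs' : s = ⋃ v, s ∩ openStar K v := by
    rw [← Set.inter_iUnion, eq_comm, Set.inter_eq_left]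
    exact fun α _ => Set.mem_iUnion.2 (exists_mem_openStar α)
  rw [hs', Set.image_iUnion]
  refine isOpen_iUnion fun v => isOpen_iff.2 fun σ => ?_
  by_cases hv : q.toFun v ∈ σ.1
  · obtain ⟨G, hGc, hG⟩ := exists_section hq v σ hv
    convert (hs.inter (isOpen_openStar v)).preimage hGc using 1
    ext α
    constructor
    · rintro ⟨β, hβ, hβα⟩
      have hα : α.1 ∈ openStar L (q.toFun v) :=
        (show map q β = α.1 from hβα) ▸ map_mem_openStar q hβ.2
      have hGα : G α ∈ openStar K v := hα.trans_eq (hG α).2.symm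
      have : G α = β := injOn_openStar hq.isLocallyInjective v hGα hβ.2 ((hG α).1.trans hβα.symm)
      rwa [Set.mem_preimage, this]
    · exact fun h => ⟨G α, h, (hG α).1⟩
  · convert isOpen_empty
    refine Set.eq_empty_of_forall_notMem ?_
    rintro α ⟨β, hβ, hβα⟩
    have hα : α.1 ∈ openStar L (q.toFun v) :=
      (show map q β = α.1 from hβα) ▸ map_mem_openStar q hβ.2
    exact hv (α.2 (mem_openStar_iff.1 hα))

/-- The realization of a simplicial covering is a covering map: it is trivial over the open star
of each vertex `y`, whose preimage is the disjoint union of the open stars of the vertices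
over `y`. -/
theorem isCoveringMap_map {q : SimplicialMap K L} (hq : q.IsSimplicialCovering) :
    IsCoveringMap (map q) := by
  intro α
  obtain ⟨y, hy⟩ := exists_mem_openStar α
  let I := {v : V // q.toFun v = y}
  let _ : TopologicalSpace I := ⊥
  have : DiscreteTopology I := ⟨rfl⟩
  have hexh : map q ⁻¹' openStar L y ⊆ ⋃ v : I, openStar K v.1 := by
    intro β hβ
    obtain ⟨v, hv, hvy⟩ := (map_mem_openStar_iff q).1 hβ
    exact Set.mem_iUnion.2 ⟨⟨v, hvy⟩, hv⟩
  have hsurj : ∀ v : I, Set.SurjOn (map q) (openStar K v.1) (openStar L y) := by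
    rintro ⟨v, rfl⟩
    exact surjOn_openStar hq v
  -- A trivialization needs a nonempty fibre, so a vertex without preimages is treated separately.
  rcases isEmpty_or_nonempty I with hI | hI
  · refine (IsEvenlyCovered.of_preimage_eq_empty I ((isOpen_openStar y).mem_nhds hy)
      ?_).to_isEvenlyCovered_preimage
    refine Set.eq_empty_of_subset_empty (hexh.trans ?_)
    simp
  · have : Nonempty (Realization K) := ⟨(hsurj (Classical.arbitrary I) hy).choose⟩
    refine (IsEvenlyCovered.of_trivialization (t := IsOpen.trivializationDiscrete
      (f := map q) (fun v : I => openStar K v.1) (openStar L y) (isOpen_openStar y) ?_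
      (fun v => injOn_openStar hq.isLocallyInjective v.1) hsurj ?_ hexh)
      hy).to_isEvenlyCovered_preimage
    · intro v s hs
      refine ⟨fun h => (h.preimage (map q).continuous).inter (isOpen_openStar v.1), fun h => ?_⟩
      convert isOpenMap_map hq _ h
      rw [Set.image_preimage_inter, Set.inter_eq_left.2 (hs.trans (hsurj v))]
    · intro v v' hne
      refine Set.disjoint_left.2 fun β h h' => hne (Subtype.ext ?_)
      exact hq.isLocallyInjective (adj_of_mem_openStar h h) (adj_of_mem_openStar h h')
        (v.2.trans v'.2.symm)

end Realization

end SimplicialCovering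

/-! ### Pullback squares of realizations -/

section Pullback

variable {A B C D : Type u} {K : PreAbstractSimplicialComplex A}
  {L : PreAbstractSimplicialComplex B} {M : PreAbstractSimplicialComplex C}
  {N : PreAbstractSimplicialComplex D}

/-- A continuous open bijection onto the fibre product exhibits a pullback in `TopCat`. -/
theorem isPullback_of_isOpenMap_of_bijective {T X Y Z : Type u} [TopologicalSpace T]
    [TopologicalSpace X] [TopologicalSpace Y] [TopologicalSpace Z] (a : C(T, X)) (b : C(T, Y))
    (f : C(X, Z)) (g : C(Y, Z)) (comm : ∀ t, f (a t) = g (b t))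
    (hopen : IsOpenMap fun t => (⟨(a t, b t), comm t⟩ : {z : X × Y // f z.1 = g z.2}))
    (hbij : Function.Bijective fun t => (⟨(a t, b t), comm t⟩ : {z : X × Y // f z.1 = g z.2})) :
    IsPullback (TopCat.ofHom a) (TopCat.ofHom b) (TopCat.ofHom f) (TopCat.ofHom g) := by
  let e : T ≃ₜ {z : X × Y // f z.1 = g z.2} :=
    (Equiv.ofBijective _ hbij).toHomeomorphOfContinuousOpen
      (Continuous.subtype_mk (by fun_prop) _) hopen
  have h := IsPullback.of_isLimit (TopCat.pullbackConeIsLimit (TopCat.ofHom f) (TopCat.ofHom g))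
  exact h.of_iso (TopCat.isoOfHomeo e).symm (Iso.refl _) (Iso.refl _) (Iso.refl _)
    (by
      ext x
      obtain ⟨t, rfl⟩ := e.surjective x
      exact congrArg a (e.symm_apply_apply t).symm)
    (by
      ext x
      obtain ⟨t, rfl⟩ := e.surjective x
      exact congrArg b (e.symm_apply_apply t).symm)
    (by simp) (by simp)

namespace Realization

/-- A commutative square of simplicial maps that is cartesian on vertices realizes to a pullback
square if one of its sides is a simplicial covering and the opposite side is locally injective.

Near a point of the open star of a vertex `k` of `K`, the inverse of the comparison map is the
local inverse of `|r|` on the open star of `r k`. -/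
theorem isPullback_map {t : SimplicialMap K L} {r : SimplicialMap K M} {q : SimplicialMap L N}
    {s : SimplicialMap M N} (comm : ∀ k, q.toFun (t.toFun k) = s.toFun (r.toFun k))
    (hr : r.IsSimplicialCovering) (hq : q.IsLocallyInjective)
    (hinj : ∀ k k', t.toFun k = t.toFun k' → r.toFun k = r.toFun k' → k = k')
    (hsurj : ∀ l m, q.toFun l = s.toFun m → ∃ k, t.toFun k = l ∧ r.toFun k = m) :
    IsPullback (TopCat.ofHom (map t)) (TopCat.ofHom (map r)) (TopCat.ofHom (map q))
      (TopCat.ofHom (map s)) := by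
  have comm' : ∀ γ : Realization K, map q (map t γ) = map s (map r γ) := by
    intro γ
    refine Subtype.ext ?_
    change (γ.1.mapDomain t.toFun).mapDomain q.toFun = (γ.1.mapDomain r.toFun).mapDomain s.toFun
    rw [← Finsupp.mapDomain_comp, ← Finsupp.mapDomain_comp]
    exact congrArg (fun g => γ.1.mapDomain g) (funext comm)
  -- A point of the fibre product over the open stars of `t k` and `r k` comes from the star of `k`.
  have lift : ∀ k γ, γ ∈ openStar K k → ∀ β ∈ openStar L (t.toFun k),
      map q β = map s (map r γ) → map t γ = β := fun k γ hγ β hβ h =>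
    injOn_openStar hq _ (map_mem_openStar t hγ) hβ ((comm' γ).trans h.symm)
  refine isPullback_of_isOpenMap_of_bijective _ _ _ _ comm' ?_ ⟨?_, ?_⟩
  · refine IsOpenMap.of_nhds_le fun γ => ?_
    obtain ⟨k, hk⟩ := exists_mem_openStar γ
    intro S hS
    obtain ⟨O, hOS, hO, hγO⟩ := mem_nhds_iff.1 (Filter.mem_map.1 hS)
    have h1 : IsOpen (map r '' (O ∩ openStar K k)) :=
      isOpenMap_map hr _ (hO.inter (isOpen_openStar k))
    have h2 : IsOpen {z : {z : Realization L × Realization M // map q z.1 = map s z.2} |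
        z.1.1 ∈ openStar L (t.toFun k) ∧ z.1.2 ∈ map r '' (O ∩ openStar K k)} :=
      ((isOpen_openStar _).preimage (by fun_prop)).inter (h1.preimage (by fun_prop))
    refine Filter.mem_of_superset (h2.mem_nhds ⟨map_mem_openStar t hk, γ, ⟨hγO, hk⟩, rfl⟩) ?_
    rintro ⟨⟨β, _⟩, h⟩ ⟨hβ, δ, ⟨hδO, hδ⟩, rfl⟩
    obtain rfl := lift k δ hδ β hβ h
    exact hOS hδO
  · intro γ γ' h
    have ht : map t γ = map t γ' := congrArg (fun z => z.1.1) h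
    have hr' : map r γ = map r γ' := congrArg (fun z => z.1.2) h
    obtain ⟨k, hk⟩ := exists_mem_openStar γ
    obtain ⟨k', hk', hkk'⟩ := (map_mem_openStar_iff r).1 (hr' ▸ map_mem_openStar r hk)
    have htk : t.toFun k = t.toFun k' := by
      have a1 := map_mem_openStar t hk
      have a2 := map_mem_openStar t hk'
      rw [← ht] at a2
      exact hq (adj_of_mem_openStar a1 a1) (adj_of_mem_openStar a1 a2)
        (by rw [comm, comm, hkk'])
    obtain rfl := hinj _ _ htk hkk'.symm
    exact injOn_openStar hr.isLocallyInjective k hk hk' hr'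
  · rintro ⟨⟨β, α⟩, h⟩
    obtain ⟨m, hm⟩ := exists_mem_openStar α
    have h' : map q β = map s α := h
    obtain ⟨l, hl, hlm⟩ := (map_mem_openStar_iff q).1 (h' ▸ map_mem_openStar s hm)
    obtain ⟨k, rfl, rfl⟩ := hsurj l m hlm
    obtain ⟨γ, hγ, rfl⟩ := surjOn_openStar hr k hm
    exact ⟨γ, Subtype.ext (Prod.ext (lift k γ hγ β hl h') rfl)⟩

end Realization

end Pullback

/-! ### Components of pulled back covers -/

theorem adj_nerve_iff {ι : Type u} {Y : Type w} {V : ι → Set Y} {i j : ι} :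
    Adj (nerve V) i j ↔ ∃ y, y ∈ V i ∧ y ∈ V j := by
  classical
  constructor
  · rintro ⟨τ, ⟨-, y, hy⟩, hi, hj⟩
    simp only [Set.mem_iInter] at hy
    exact ⟨y, hy i hi, hy j hj⟩
  · rintro ⟨y, hi, hj⟩
    refine ⟨{i, j}, ⟨by simp, y, ?_⟩, by simp, by simp⟩
    simp [hi, hj]

section PullbackCover

variable {ι : Type u} {X : Type v} {Y : Type w} [TopologicalSpace X] [TopologicalSpace Y]

theorem pullbackCover_nonempty (f : C(X, Y)) (U : ι → Set Y) (a : PullbackIndex f U) :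
    (pullbackCover f U a).Nonempty := by
  obtain ⟨i, A⟩ := a
  obtain ⟨x, rfl⟩ := ZerothHomotopy.mk_surjective A
  exact ⟨x.1, x.2, rfl⟩

theorem mem_pullbackCover_mk (f : C(X, Y)) (U : ι → Set Y) {i : ι} {x : X} (h : x ∈ f ⁻¹' U i) :
    x ∈ pullbackCover f U ⟨i, ZerothHomotopy.mk ⟨x, h⟩⟩ := ⟨h, rfl⟩

/-- The components of `f⁻¹(U i)`, for a fixed `i`, are disjoint. -/
theorem eq_of_mem_pullbackCover {f : C(X, Y)} {U : ι → Set Y} {a b : PullbackIndex f U} {x : X}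
    (ha : x ∈ pullbackCover f U a) (hb : x ∈ pullbackCover f U b) (hab : a.1 = b.1) : a = b := by
  obtain ⟨i, A⟩ := a
  obtain ⟨j, B⟩ := b
  obtain rfl : i = j := hab
  exact congrArg (Sigma.mk i) (ha.choose_spec.symm.trans hb.choose_spec)

theorem joinedIn_of_mem_pullbackCover {f : C(X, Y)} {U : ι → Set Y} {a : PullbackIndex f U}
    {x y : X} (hx : x ∈ pullbackCover f U a) (hy : y ∈ pullbackCover f U a) :
    JoinedIn (f ⁻¹' U a.1) x y := by
  obtain ⟨hx, hxa⟩ := hx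
  obtain ⟨hy, hya⟩ := hy
  exact (joinedIn_iff_joined hx hy).2 (Quotient.exact (hxa.trans hya.symm))

theorem mem_pullbackCover_of_joinedIn {f : C(X, Y)} {U : ι → Set Y} {a : PullbackIndex f U}
    {x y : X} (hx : x ∈ pullbackCover f U a) (hxy : JoinedIn (f ⁻¹' U a.1) x y) :
    y ∈ pullbackCover f U a := by
  obtain ⟨hx, hxa⟩ := hx
  refine ⟨hxy.target_mem, (Quotient.sound ?_).trans hxa⟩
  exact ((joinedIn_iff_joined hx hxy.target_mem).1 hxy).symm

end PullbackCover

/-! ### Pulling back a good cover along a covering map -/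

section Covering

variable {ι : Type u} {X : Type v} {Y : Type w} [TopologicalSpace X] [TopologicalSpace Y]
  {E : Type*} [TopologicalSpace E] {p : C(E, Y)} {U : ι → Set Y}

theorem IsGoodCover.contractibleSpace (hU : IsGoodCover U) {i : ι} {y : Y} (hy : y ∈ U i) :
    ContractibleSpace (U i) := by
  have h := hU.contractible {i} ⟨by simp, y, by simpa using hy⟩
  have e : (⋂ j ∈ ({i} : Finset ι), U j) = U i := by simp
  rwa [e] at h

theorem IsGoodCover.joinedIn_inter (hU : IsGoodCover U) {i j : ι} {y z : Y}
    (hy : y ∈ U i ∩ U j) (hz : z ∈ U i ∩ U j) : JoinedIn (U i ∩ U j) y z := by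
  classical
  have h := hU.contractible {i, j} ⟨by simp, y, by simpa using hy⟩
  have e : (⋂ k ∈ ({i, j} : Finset ι), U k) = U i ∩ U j := by simp
  rw [e] at h
  exact (isPathConnected_iff_pathConnectedSpace.2 inferInstance).joinedIn y hy z hz

theorem joinedIn_of_path {Z : Type*} [TopologicalSpace Z] {s : Set Z} (γ : C(unitInterval, Z))
    (h : ∀ t, γ t ∈ s) (a b : unitInterval) : JoinedIn s (γ a) (γ b) :=
  have : PathConnectedSpace unitInterval := isPathConnected_iff_pathConnectedSpace.1
    ((convex_Icc (0 : ℝ) 1).isPathConnected ⟨0, unitInterval.zero_mem⟩)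
  ((isPathConnected_range γ.continuous).joinedIn _ ⟨a, rfl⟩ _ ⟨b, rfl⟩).mono
    (Set.range_subset_iff.2 h)

/-- A path inside `s` lifts to a path inside `p⁻¹(s)`. -/
theorem exists_joinedIn_lift (hp : IsCoveringMap p) {s : Set Y} {y : Y} {e : E}
    (h : JoinedIn s (p e) y) : ∃ e', p e' = y ∧ JoinedIn (p ⁻¹' s) e e' := by
  obtain ⟨γ, hγ⟩ := h
  obtain ⟨Γ, hΓ, hΓ0⟩ := hp.exists_path_lifts γ.toContinuousMap e (by simp)
  have hΓ' : ∀ t, p (Γ t) = γ t := congrFun hΓ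
  refine ⟨Γ 1, by simp [hΓ'], ?_⟩
  have := joinedIn_of_path (s := p ⁻¹' s) Γ (fun t => by simp [hΓ', hγ]) 0 1
  rwa [hΓ0] at this

/-- A component of `p⁻¹(U i)` is mapped injectively to `U i`, as `U i` is simply connected. -/
theorem injOn_pullbackCover (hp : IsCoveringMap p) (hU : IsGoodCover U) (b : PullbackIndex p U) :
    Set.InjOn p (pullbackCover p U b) := by
  intro e he e' he' hee'
  obtain ⟨γ, hγ⟩ := joinedIn_of_mem_pullbackCover he he'
  have := hU.contractibleSpace (hγ 0)
  let δ : Path (⟨p e, by simpa using hγ 0⟩ : U b.1) ⟨p e, by simpa using hγ 0⟩ :=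
    { toFun := fun t => ⟨p (γ t), hγ t⟩
      continuous_toFun := by fun_prop
      source' := by simp
      target' := by simp [hee'] }
  have hδ := (SimplyConnectedSpace.paths_homotopic δ (Path.refl _)).map
    (⟨Subtype.val, continuous_subtype_val⟩ : C(U b.1, Y))
  -- The image of a path from `e` to `e'` is a null-homotopic loop in `U i`, so its lift is closed.
  have h := hp.liftPath_apply_one_eq_of_homotopicRel hδ e (by simp) (by simp)
  have h1 : γ.toContinuousMap = hp.liftPath (δ.map continuous_subtype_val).toContinuousMap e
      (by simp) := (hp.eq_liftPath_iff' _).2 ⟨rfl, by simp⟩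
  have h2 : ContinuousMap.const unitInterval e = hp.liftPath
      ((Path.refl (⟨p e, by simpa using hγ 0⟩ : U b.1)).map continuous_subtype_val).toContinuousMap
      e (by simp) := (hp.eq_liftPath_iff' _).2 ⟨rfl, rfl⟩
  have h3 : γ.toContinuousMap 1 = ContinuousMap.const unitInterval e 1 := by
    rw [h1, h2]; exact h
  simpa using h3.symm

/-- If components of `p⁻¹(U i)` and `p⁻¹(U j)` meet, then their intersection is mapped onto
`U i ∩ U j`, as `U i ∩ U j` is path connected. -/
theorem surjOn_inter_pullbackCover (hp : IsCoveringMap p) (hU : IsGoodCover U)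
    {b c : PullbackIndex p U} (hbc : (pullbackCover p U b ∩ pullbackCover p U c).Nonempty) :
    Set.SurjOn p (pullbackCover p U b ∩ pullbackCover p U c) (U b.1 ∩ U c.1) := by
  obtain ⟨e, he, he'⟩ := hbc
  intro y hy
  obtain ⟨e', rfl, h⟩ := exists_joinedIn_lift hp (hU.joinedIn_inter ⟨he.1, he'.1⟩ hy)
  exact ⟨e', ⟨mem_pullbackCover_of_joinedIn he (h.mono fun _ h => h.1),
    mem_pullbackCover_of_joinedIn he' (h.mono fun _ h => h.2)⟩, rfl⟩

theorem exists_mem_pullbackCover (hp : IsCoveringMap p) (hU : IsGoodCover U)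
    (b : PullbackIndex p U) {y : Y} (hy : y ∈ U b.1) : ∃ e ∈ pullbackCover p U b, p e = y := by
  have h : (pullbackCover p U b ∩ pullbackCover p U b).Nonempty := by
    simpa using pullbackCover_nonempty p U b
  obtain ⟨e, he, rfl⟩ := surjOn_inter_pullbackCover hp hU h ⟨hy, hy⟩
  exact ⟨e, he.1, rfl⟩

/-- Let the components `c` and `c'` of `p⁻¹(U j)` both meet the component `b` of `p⁻¹(U i)`. Over the
image of a point of `b ∩ c'` there is a point of `b ∩ c`, and the two agree because both lie in `b`.
Hence `c` meets `c'`. -/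
theorem isLocallyInjective_mapperToNerve (hp : IsCoveringMap p) (hU : IsGoodCover U) :
    (mapperToNerve U p).IsLocallyInjective := by
  intro b c c' hbc hbc' hcc'
  obtain ⟨e, he⟩ := adj_nerve_iff.1 hbc
  obtain ⟨e', he'⟩ := adj_nerve_iff.1 hbc'
  have hcc' : c.1 = c'.1 := hcc'
  obtain ⟨d, hd, hde⟩ := surjOn_inter_pullbackCover hp hU ⟨e, he⟩
    (show p e' ∈ U b.1 ∩ U c.1 from ⟨he'.1.1, hcc' ▸ he'.2.1⟩)
  obtain rfl := injOn_pullbackCover hp hU b hd.1 he'.1 hde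
  exact eq_of_mem_pullbackCover hd.2 he'.2 hcc'

variable (f : C(X, Y))

theorem mem_pullbackCover_unrollVertex {c : PullbackIndex (pullbackMap p f) (pullbackCover p U)}
    {z : FibreProduct p f} (hz : z ∈ pullbackCover (pullbackMap p f) (pullbackCover p U) c) :
    z.1.1 ∈ pullbackCover f U (unrollVertex p f U c) := by
  obtain ⟨hm, he⟩ := hz
  refine ⟨(projRestrict p f U c.1 ⟨z, hm⟩).2, ?_⟩
  simp only [unrollVertex, ← he, ZerothHomotopy.lift_mk]
  rfl

/-- The fibre product is cartesian on `π₀`: for a component `V` of `p⁻¹(U i)`, distinct components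
of `f'⁻¹(V)` lie over distinct components of `f⁻¹(U i)`. A path in `f⁻¹(U i)` lifts to
`f'⁻¹(V)`, since its image in `U i` lifts to `V`. -/
theorem unrollVertex_injective (hp : IsCoveringMap p) (hU : IsGoodCover U)
    {c c' : PullbackIndex (pullbackMap p f) (pullbackCover p U)} (h : c.1 = c'.1)
    (h' : unrollVertex p f U c = unrollVertex p f U c') : c = c' := by
  obtain ⟨z, hz⟩ := pullbackCover_nonempty (pullbackMap p f) (pullbackCover p U) c
  obtain ⟨z', hz'⟩ := pullbackCover_nonempty (pullbackMap p f) (pullbackCover p U) c'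
  have hx' := mem_pullbackCover_unrollVertex f hz'
  rw [← h'] at hx'
  obtain ⟨γ, hγ⟩ := joinedIn_of_mem_pullbackCover (mem_pullbackCover_unrollVertex f hz) hx'
  have hγ : ∀ t, f (γ t) ∈ U c.1.1 := hγ
  obtain ⟨Γ, hΓ, hΓ0⟩ := hp.exists_path_lifts (f.comp γ.toContinuousMap) z.1.2
    (by simpa using z.2)
  have hΓ' : ∀ t, p (Γ t) = f (γ t) := congrFun hΓ
  have he : z.1.2 ∈ pullbackCover p U c.1 := hz.1
  have he' : z'.1.2 ∈ pullbackCover p U c.1 := h ▸ hz'.1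
  have hΓV : ∀ t, Γ t ∈ pullbackCover p U c.1 := fun t => by
    refine mem_pullbackCover_of_joinedIn he ?_
    rw [← hΓ0]
    exact joinedIn_of_path Γ (fun t => by simp [hΓ', hγ]) 0 t
  have hΓ1 : Γ 1 = z'.1.2 := by
    refine injOn_pullbackCover hp hU c.1 (hΓV 1) he' ?_
    rw [hΓ', γ.target, z'.2]
  let Λ : C(unitInterval, FibreProduct p f) := ⟨fun t => ⟨(γ t, Γ t), (hΓ' t).symm⟩, by fun_prop⟩
  have hΛ := joinedIn_of_path (s := pullbackMap p f ⁻¹' pullbackCover p U c.1) Λ hΓV 0 1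
  have hΛ0 : Λ 0 = z := Subtype.ext (Prod.ext γ.source hΓ0)
  have hΛ1 : Λ 1 = z' := Subtype.ext (Prod.ext γ.target hΓ1)
  rw [hΛ0, hΛ1] at hΛ
  exact eq_of_mem_pullbackCover (mem_pullbackCover_of_joinedIn hz hΛ) hz' h

/-- For a component `V` of `p⁻¹(U i)`, every component of `f⁻¹(U i)` is the image of a component of
`f'⁻¹(V)`. -/
theorem exists_unrollVertex_eq (hp : IsCoveringMap p) (hU : IsGoodCover U)
    {b : PullbackIndex p U} {a : PullbackIndex f U} (hab : b.1 = a.1) :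
    ∃ c : PullbackIndex (pullbackMap p f) (pullbackCover p U),
      c.1 = b ∧ unrollVertex p f U c = a := by
  obtain ⟨x, hx⟩ := pullbackCover_nonempty f U a
  obtain ⟨e, he, hex⟩ := exists_mem_pullbackCover hp hU b (y := f x) (hab ▸ hx.1)
  let z : FibreProduct p f := ⟨(x, e), hex.symm⟩
  have hz := mem_pullbackCover_mk (pullbackMap p f) (pullbackCover p U) (i := b) (x := z) he
  exact ⟨_, rfl, eq_of_mem_pullbackCover (mem_pullbackCover_unrollVertex f hz) hx hab⟩

theorem isSimplicialCovering_unrollMap (hp : IsCoveringMap p) (hU : IsGoodCover U) :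
    (unrollMap p f U).IsSimplicialCovering where
  isLocallyInjective := by
    intro k c c' hkc hkc' hcc'
    obtain ⟨z, hz⟩ := adj_nerve_iff.1 hkc
    obtain ⟨z', hz'⟩ := adj_nerve_iff.1 hkc'
    have h1 : c.1 = c'.1 := isLocallyInjective_mapperToNerve hp hU
      (adj_nerve_iff.2 ⟨z.1.2, hz.1.1, hz.2.1⟩) (adj_nerve_iff.2 ⟨z'.1.2, hz'.1.1, hz'.2.1⟩)
      (congrArg Sigma.fst hcc' : (unrollVertex p f U c).1 = (unrollVertex p f U c').1)
    exact unrollVertex_injective f hp hU h1 hcc'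
  exists_lift := by
    classical
    rintro k σ ⟨hne, x, hx⟩ hk
    simp only [Set.mem_iInter] at hx
    have hk : unrollVertex p f U k ∈ σ := hk
    -- Choose a common point of the members of `σ`, and lift it into the component `k.1`.
    obtain ⟨e, he, hex⟩ := exists_mem_pullbackCover hp hU k.1 (y := f x) (hx _ hk).1
    let z : FibreProduct p f := ⟨(x, e), hex.symm⟩
    -- The lift consists of the components that contain the point `(x, e)`.
    have hlift : ∀ a : σ, ∃ c : PullbackIndex (pullbackMap p f) (pullbackCover p U),
        z ∈ pullbackCover (pullbackMap p f) (pullbackCover p U) c ∧ unrollVertex p f U c = a := by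
      intro a
      have he' : e ∈ p ⁻¹' U a.1.1 := by
        rw [Set.mem_preimage, hex]; exact (hx a.1 a.2).1
      have hz := mem_pullbackCover_mk (pullbackMap p f) (pullbackCover p U)
        (x := z) (mem_pullbackCover_mk p U he')
      exact ⟨_, hz, eq_of_mem_pullbackCover (mem_pullbackCover_unrollVertex f hz) (hx a.1 a.2) rfl⟩
    choose g hg hga using hlift
    refine ⟨Finset.univ.image g, ⟨⟨g ⟨_, hk⟩, by simp⟩, z, ?_⟩, ?_, ?_⟩
    · simp only [Set.mem_iInter]
      intro c hc
      obtain ⟨a, -, rfl⟩ := Finset.mem_image.1 hc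
      exact hg a
    · refine Finset.mem_image.2 ⟨⟨_, hk⟩, Finset.mem_univ _, ?_⟩
      refine unrollVertex_injective f hp hU ?_ (hga _)
      exact eq_of_mem_pullbackCover (hg _).1 he
        (congrArg Sigma.fst (hga ⟨_, hk⟩) :
          (unrollVertex p f U (g ⟨_, hk⟩)).1 = (unrollVertex p f U k).1)
    · ext a
      constructor
      · rintro ⟨c, hc, rfl⟩
        obtain ⟨a, -, rfl⟩ := Finset.mem_image.1 (Finset.mem_coe.1 hc)
        change unrollVertex p f U (g a) ∈ (σ : Set _)
        rw [hga a]
        exact a.2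
      · intro ha
        exact ⟨g ⟨a, ha⟩, by simp, hga ⟨a, ha⟩⟩

end Covering

/-! ### The universal covering of the circle -/

theorem isCoveringMap_circleCover : IsCoveringMap circleCover :=
  Circle.isCoveringMap_exp.comp_homeomorph
    (Homeomorph.mulLeft₀ (2 * Real.pi) Real.two_pi_pos.ne')

end MapperGraph
end

theorem mainTheorem6 {ι X : Type u} [Finite ι] [TopologicalSpace X]
    (U : ι → Set Circle) (hU : MapperGraph.IsGoodCover U) (f : C(X, Circle)) :
    let p := MapperGraph.circleCover
    let f' := MapperGraph.pullbackMap p f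
    let pU := MapperGraph.pullbackCover p U
    let Fstar := MapperGraph.Realization.map (MapperGraph.mapperToNerve pU f')
    let F := MapperGraph.Realization.map (MapperGraph.mapperToNerve U f)
    let P := MapperGraph.Realization.map (MapperGraph.mapperToNerve U p)
    let Pstar := MapperGraph.Realization.map (MapperGraph.unrollMap p f U)
    IsPullback (TopCat.ofHom Fstar) (TopCat.ofHom Pstar) (TopCat.ofHom P) (TopCat.ofHom F) ∧
      IsCoveringMap Pstar := by
  intro p f' pU Fstar F P Pstar
  have hp := MapperGraph.isCoveringMap_circleCover
  have hcov := MapperGraph.isSimplicialCovering_unrollMap f hp hU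
  refine ⟨MapperGraph.Realization.isPullback_map (fun _ => rfl) hcov
    (MapperGraph.isLocallyInjective_mapperToNerve hp hU) ?_ ?_,
    MapperGraph.Realization.isCoveringMap_map hcov⟩
  · exact fun _ _ h h' => MapperGraph.unrollVertex_injective f hp hU h h'
  · exact fun _ _ h => MapperGraph.exists_unrollVertex_eq f hp hU h
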